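/- Let $r\ge 0$ be an integer and let $\gamma:S^1=\mathbb R/2\pi\mathbb Z\to\mathbb R^{r+1}$ be a closed frontal, that is, a smooth $2\pi$-periodic map $\gamma:\mathbb R\to\mathbb R^{r+1}$ whose regular set $\{t:\gamma'(t)\neq 0\}$ is dense and for which there is a smooth map $\mathbf e:\mathbb R\to S^r$ such that $\gamma'(t)$ and $\mathbf e(t)$ are linearly dependent for every $t$ (the map $\mathbf e$ need not be $2\pi$-periodic). Suppose that every singular point of $\gamma$ is non-degenerate, i.e. is a generalized cusp: $\gamma''(c)\ne 0$ whenever $\gamma'(c)=0$. Let $\Sigma_\gamma\subset S^1$ be the set of singular points (the zeros of $\gamma'$), let $$\kappa=\frac{\sqrt{\|\gamma''\|^2\|\gamma'\|^2-(\gamma''\cdot\gamma')^2}}{\|\gamma'\|^3}$$ be the curvature function on the regular set, and let $ds=\|\gamma'(t)\|\,dt$. Then $\Sigma_\gamma$ is finite, $\kappa\,ds$ is integrable over $S^1$, and $$\frac1\pi\int_{S^1}\kappa\,ds+\#\Sigma_\gamma\ \ge\ 2 .$$ Moreover, if $\Sigma_\gamma\neq\emptyset$, then equality holds if and only if $\#\Sigma_\gamma=2$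 and the image of $\gamma$ is a line segment (with distinct endpoints). -/

import Mathlib

open scoped ContDiff Real

noncomputable section

/-- A closed frontal `γ : S¹ = ℝ / 2πℤ → ℝ^{r+1}`, given as a `2π`-periodic smooth map on `ℝ`
whose regular set is dense and along which there is a smooth unit tangent vector field
`e : ℝ → S^r`, so that `γ'(t)` and `e(t)` are linearly dependent for every `t`.
The field `e` itself is not required to be `2π`-periodic. -/
structure IsClosedFrontal {r : ℕ} (γ : ℝ → EuclideanSpace ℝ (Fin (r + 1))) : Prop where
  smooth : ContDiff ℝ ∞ γ
  periodic : Function.Periodic γ (2 * π)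
  dense_regular : Dense {t : ℝ | deriv γ t ≠ 0}
  exists_unitTangent : ∃ e : ℝ → EuclideanSpace ℝ (Fin (r + 1)),
    ContDiff ℝ ∞ e ∧ (∀ t, ‖e t‖ = 1) ∧ ∀ t, deriv γ t ∈ Submodule.span ℝ {e t}

/-- A generalized cusp: a singular point `c` of `γ` at which `γ''` does not vanish. For
frontal curves these are exactly the non-degenerate singular points. -/
def IsGeneralizedCusp {r : ℕ} (γ : ℝ → EuclideanSpace ℝ (Fin (r + 1))) (c : ℝ) : Prop :=
  deriv γ c = 0 ∧ deriv (deriv γ) c ≠ 0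

/-- The singular set `Σ_γ` in `S¹ = ℝ / 2πℤ`, represented in the fundamental domain `[0, 2π)`. -/
def singularSet {r : ℕ} (γ : ℝ → EuclideanSpace ℝ (Fin (r + 1))) : Set ℝ :=
  {t | t ∈ Set.Ico 0 (2 * π) ∧ deriv γ t = 0}

/-- The curvature function `κ` of a curve, meaningful at its regular points. -/
def curvature {r : ℕ} (γ : ℝ → EuclideanSpace ℝ (Fin (r + 1))) (t : ℝ) : ℝ :=
  √(‖deriv (deriv γ) t‖ ^ 2 * ‖deriv γ t‖ ^ 2 - inner ℝ (deriv (deriv γ) t) (deriv γ t) ^ 2) /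
    ‖deriv γ t‖ ^ 3

/-- The density `κ ds / dt = κ(t) ‖γ'(t)‖` of the curvature measure (`0` at singular points). -/
def curvatureDensity {r : ℕ} (γ : ℝ → EuclideanSpace ℝ (Fin (r + 1))) (t : ℝ) : ℝ :=
  curvature γ t * ‖deriv γ t‖

end

/-! Write `γ' = ρ e` with `e` a curve on the unit sphere and `ρ` a real function. The generalized
cusps are exactly the zeros of `ρ`, all simple, hence finitely many per period. Off them `κ ds =
‖e'‖ dt`, so the total curvature is the length `L` of `e` over one period, and the claim concerns
lengths of spherical curves.

With at least two cusps the inequality is trivial. Without cusps `ρ` keeps its sign, so `e` closes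
up; if `L < 2π`, it would lie in an open hemisphere, and the height of `γ` towards its pole would
have nowhere vanishing derivative, against Rolle (`two_pi_le_length_of_ne_zero`). With one cusp,
start the period there: `e` need not close up, but if `L ≤ π` it lies in the closed hemisphere about
its midpoint `e m`. The height of `γ` along `e m` is then monotone with equal end values, hence
constant, which forces `⟪e m, e m⟫ = 0` (`pi_lt_length_of_ne_zero`).

The one-cusp bound is strict, so equality in the presence of cusps means two cusps and `L = 0`: `e`
is constant and `γ` runs along a segment. -/

open Set MeasureTheory Filter Topology
open scoped RealInnerProductSpace

/-! ### Lengths and hemispheres of spherical curves. -/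

section SphericalCurves

variable {E : Type*} [NormedAddCommGroup E] [InnerProductSpace ℝ E]

/-- A unit vector field is orthogonal to its derivative. -/
lemma inner_deriv_eq_zero_of_norm_eq_one {e : ℝ → E} (he : Differentiable ℝ e)
    (h1 : ∀ t, ‖e t‖ = 1) (t : ℝ) : ⟪e t, deriv e t⟫ = 0 := by
  have h := (he t).hasDerivAt.inner ℝ (he t).hasDerivAt
  have h2 : (fun t => ⟪e t, e t⟫) = fun _ => (1 : ℝ) := by
    funext t; rw [real_inner_self_eq_norm_sq, h1]; norm_num
  rw [h2] at h
  have := h.unique (hasDerivAt_const t (1 : ℝ))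
  linarith [real_inner_comm (e t) (deriv e t)]

/-- The derivative of a height function along a unit vector field. -/
lemma abs_inner_deriv_le {e : ℝ → E} (he : Differentiable ℝ e) (h1 : ∀ t, ‖e t‖ = 1)
    {p : E} (hp : ‖p‖ = 1) (t : ℝ) :
    |⟪p, deriv e t⟫| ≤ ‖deriv e t‖ * √(1 - ⟪p, e t⟫ ^ 2) := by
  have h0 := inner_deriv_eq_zero_of_norm_eq_one he h1 t
  -- As `e' ⟂ e`, only the component of `p` orthogonal to `e t` contributes.
  have h2 : ⟪p, deriv e t⟫ = ⟪p - ⟪p, e t⟫ • e t, deriv e t⟫ := by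
    rw [inner_sub_left, inner_smul_left, h0]; simp
  have h3 : ‖p - ⟪p, e t⟫ • e t‖ ^ 2 = 1 - ⟪p, e t⟫ ^ 2 := by
    rw [norm_sub_sq_real, inner_smul_right, norm_smul, hp, h1, mul_one, Real.norm_eq_abs, sq_abs]
    ring
  rw [h2, ← h3, Real.sqrt_sq (norm_nonneg _), mul_comm]
  exact abs_real_inner_le_norm _ _

/-- The angle between two points of a spherical curve is at most the length between them. -/
lemma arccos_inner_le_integral {e : ℝ → E} (he : ContDiff ℝ 1 e) (h1 : ∀ t, ‖e t‖ = 1)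
    {s t : ℝ} (hst : s ≤ t) :
    Real.arccos ⟪e s, e t⟫ ≤ ∫ u in s..t, ‖deriv e u‖ := by
  have hd : Differentiable ℝ e := he.differentiable one_ne_zero
  have hc : Continuous fun u => ‖deriv e u‖ := (he.continuous_deriv le_rfl).norm
  have hle : ∀ u, |⟪e s, e u⟫| ≤ 1 := fun u => by
    have := abs_real_inner_le_norm (e s) (e u)
    rwa [h1, h1, one_mul] at this
  -- `arccos` is not differentiable at `±1`; damping the inner product by `c < 1` avoids these
  -- points, and `c → 1` at the end.
  have key : ∀ c ∈ Ioo (0 : ℝ) 1,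
      Real.arccos (c * ⟪e s, e t⟫) ≤ Real.arccos c + ∫ u in s..t, ‖deriv e u‖ := by
    rintro c ⟨hc0, hc1⟩
    have hlt : ∀ u, |c * ⟪e s, e u⟫| < 1 := fun u => by
      rw [abs_mul, abs_of_pos hc0]
      nlinarith [hle u, abs_nonneg ⟪e s, e u⟫]
    have hder : ∀ u, HasDerivAt (fun u => (∫ v in s..u, ‖deriv e v‖) - Real.arccos (c * ⟪e s, e u⟫))
        (‖deriv e u‖ - -(1 / √(1 - (c * ⟪e s, e u⟫) ^ 2)) * (c * ⟪e s, deriv e u⟫)) u := by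
      intro u
      have hi : HasDerivAt (fun u => ⟪e s, e u⟫) ⟪e s, deriv e u⟫ u := by
        simpa using (hasDerivAt_const u (e s)).inner ℝ (hd u).hasDerivAt
      exact (hc.integral_hasStrictDerivAt s u).hasDerivAt.sub
        (HasDerivAt.comp (h₂ := Real.arccos) (h := fun u => c * ⟪e s, e u⟫) u
          (Real.hasDerivAt_arccos (abs_lt.1 (hlt u)).1.ne' (abs_lt.1 (hlt u)).2.ne)
          (hi.const_mul c))
    have hmono := monotone_of_deriv_nonneg (fun u => (hder u).differentiableAt) fun u => by
      rw [(hder u).deriv]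
      have hpos : 0 < 1 - (c * ⟪e s, e u⟫) ^ 2 := by
        have := (sq_lt_one_iff_abs_lt_one _).2 (hlt u); linarith
      have hb := abs_inner_deriv_le hd h1 (h1 s) u
      have hsq : c * √(1 - ⟪e s, e u⟫ ^ 2) ≤ √(1 - (c * ⟪e s, e u⟫) ^ 2) := by
        rw [← Real.sqrt_sq hc0.le, ← Real.sqrt_mul (sq_nonneg c), Real.sqrt_sq hc0.le]
        exact Real.sqrt_le_sqrt (by nlinarith)
      have hq := Real.sqrt_pos.2 hpos
      have h3 : -(c * ⟪e s, deriv e u⟫) ≤ ‖deriv e u‖ * √(1 - (c * ⟪e s, e u⟫) ^ 2) := by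
        calc -(c * ⟪e s, deriv e u⟫) = c * -⟪e s, deriv e u⟫ := by ring
          _ ≤ c * (‖deriv e u‖ * √(1 - ⟪e s, e u⟫ ^ 2)) :=
            mul_le_mul_of_nonneg_left ((neg_le_abs _).trans hb) hc0.le
          _ = ‖deriv e u‖ * (c * √(1 - ⟪e s, e u⟫ ^ 2)) := by ring
          _ ≤ _ := mul_le_mul_of_nonneg_left hsq (norm_nonneg _)
      have h4 := (div_le_iff₀ hq).2 h3
      have h5 : ‖deriv e u‖ - -(1 / √(1 - (c * ⟪e s, e u⟫) ^ 2)) * (c * ⟪e s, deriv e u⟫)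
          = ‖deriv e u‖ - -(c * ⟪e s, deriv e u⟫) / √(1 - (c * ⟪e s, e u⟫) ^ 2) := by ring
      rw [h5]
      exact sub_nonneg.2 h4
    have := hmono hst
    simp only [intervalIntegral.integral_same, real_inner_self_eq_norm_sq, h1] at this
    norm_num at this
    linarith
  have hl : Tendsto (fun c : ℝ => Real.arccos (c * ⟪e s, e t⟫)) (𝓝[<] 1)
      (𝓝 (Real.arccos (1 * ⟪e s, e t⟫))) :=
    ((Real.continuous_arccos.comp (continuous_id.mul continuous_const)).tendsto
      (1 : ℝ)).mono_left nhdsWithin_le_nhds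
  have hr : Tendsto (fun c : ℝ => Real.arccos c + ∫ u in s..t, ‖deriv e u‖) (𝓝[<] 1)
      (𝓝 (Real.arccos 1 + ∫ u in s..t, ‖deriv e u‖)) :=
    ((Real.continuous_arccos.add continuous_const).tendsto (1 : ℝ)).mono_left nhdsWithin_le_nhds
  have := le_of_tendsto_of_tendsto hl hr
    (by filter_upwards [Ioo_mem_nhdsLT (zero_lt_one' ℝ)] with c hc using key c hc)
  simpa using this

/-- Since `cos` decreases on `[0, π]`, angle `xy` below `π` minus angle `yz` means `⟪x, y⟫ > -⟪y,
z⟫`. -/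
lemma inner_add_inner_pos_of_arccos_add_lt {x y z : E} (hx : ‖x‖ = 1) (hy : ‖y‖ = 1)
    (hz : ‖z‖ = 1) (h : Real.arccos ⟪x, y⟫ + Real.arccos ⟪y, z⟫ < π) :
    0 < ⟪y, x + z⟫ := by
  have hb : ∀ {a b : E}, ‖a‖ = 1 → ‖b‖ = 1 → -1 ≤ ⟪a, b⟫ ∧ ⟪a, b⟫ ≤ 1 := fun {a b} ha hb => by
    have := abs_real_inner_le_norm a b
    rw [ha, hb, one_mul] at this
    exact abs_le.1 this
  have := Real.cos_lt_cos_of_nonneg_of_le_pi (Real.arccos_nonneg ⟪x, y⟫)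
    (y := π - Real.arccos ⟪y, z⟫) (by linarith [Real.arccos_nonneg ⟪y, z⟫]) (by linarith)
  rw [Real.cos_pi_sub, Real.cos_arccos (hb hx hy).1 (hb hx hy).2,
    Real.cos_arccos (hb hy hz).1 (hb hy hz).2] at this
  rw [inner_add_right, real_inner_comm]
  linarith

/-- The point bisecting the length of a curve. -/
lemma exists_integral_norm_deriv_eq_half {e : ℝ → E} (he : ContDiff ℝ 1 e) {a b : ℝ}
    (hab : a ≤ b) : ∃ m ∈ Icc a b,
      (∫ u in a..m, ‖deriv e u‖) = (∫ u in a..b, ‖deriv e u‖) / 2 ∧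
      (∫ u in m..b, ‖deriv e u‖) = (∫ u in a..b, ‖deriv e u‖) / 2 := by
  have hc : Continuous fun u => ‖deriv e u‖ := (he.continuous_deriv le_rfl).norm
  have hcont : Continuous fun m => ∫ u in a..m, ‖deriv e u‖ :=
    intervalIntegral.continuous_primitive (fun _ _ => hc.intervalIntegrable _ _) a
  have h0 : 0 ≤ ∫ u in a..b, ‖deriv e u‖ :=
    intervalIntegral.integral_nonneg hab fun _ _ => norm_nonneg _
  obtain ⟨m, hm, h⟩ := intermediate_value_Icc hab hcont.continuousOn
    (show (∫ u in a..b, ‖deriv e u‖) / 2 ∈ Icc _ _ by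
      simp only [intervalIntegral.integral_same]
      constructor <;> linarith)
  refine ⟨m, hm, h, ?_⟩
  have := intervalIntegral.integral_add_adjacent_intervals (μ := volume) (hc.intervalIntegrable a m)
    (hc.intervalIntegrable m b)
  simp only at h
  linarith

/-- A closed spherical curve of length less than `2π` lies in an open hemisphere. -/
lemma exists_inner_pos_of_length_lt_two_pi {e : ℝ → E} (he : ContDiff ℝ 1 e)
    (h1 : ∀ t, ‖e t‖ = 1) {a b : ℝ} (hab : a ≤ b) (hclosed : e a = e b)
    (hL : ∫ u in a..b, ‖deriv e u‖ < 2 * π) : ∃ v : E, ∀ t ∈ Icc a b, 0 < ⟪e t, v⟫ := by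
  have hc : Continuous fun u => ‖deriv e u‖ := (he.continuous_deriv le_rfl).norm
  obtain ⟨m, hm, ham, hmb⟩ := exists_integral_norm_deriv_eq_half he hab
  have key : ∀ s t u, s ≤ t → t ≤ u → (∫ u in s..u, ‖deriv e u‖) < π →
      0 < ⟪e t, e s + e u⟫ := fun s t u hst htu h => by
    apply inner_add_inner_pos_of_arccos_add_lt (h1 _) (h1 _) (h1 _)
    have := intervalIntegral.integral_add_adjacent_intervals (μ := volume) (hc.intervalIntegrable s t)
      (hc.intervalIntegrable t u)
    linarith [arccos_inner_le_integral he h1 hst, arccos_inner_le_integral he h1 htu]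
  -- Both halves join `e a` and `e m` with length below `π`, so the same pole serves for both.
  refine ⟨e a + e m, fun t ht => ?_⟩
  rcases le_total t m with h | h
  · exact key a t m ht.1 h (by linarith)
  · rw [hclosed, add_comm]
    exact key m t b h ht.2 (by linarith)

/-- A spherical curve of length at most `π` lies in a closed hemisphere centred on the curve. -/
lemma exists_inner_nonneg_of_length_le_pi {e : ℝ → E} (he : ContDiff ℝ 1 e)
    (h1 : ∀ t, ‖e t‖ = 1) {a b : ℝ} (hab : a ≤ b)
    (hL : ∫ u in a..b, ‖deriv e u‖ ≤ π) : ∃ m ∈ Icc a b, ∀ t ∈ Icc a b, 0 ≤ ⟪e t, e m⟫ := by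
  have hc : Continuous fun u => ‖deriv e u‖ := (he.continuous_deriv le_rfl).norm
  obtain ⟨m, hm, ham, hmb⟩ := exists_integral_norm_deriv_eq_half he hab
  have hn : ∀ s t, s ≤ t → 0 ≤ ∫ u in s..t, ‖deriv e u‖ := fun s t hst =>
    intervalIntegral.integral_nonneg hst fun _ _ => norm_nonneg _
  -- Every point is within arc length `π / 2` of the midpoint.
  refine ⟨m, hm, fun t ht => ?_⟩
  rcases le_total t m with h | h
  · have := intervalIntegral.integral_add_adjacent_intervals (μ := volume) (hc.intervalIntegrable a t)
      (hc.intervalIntegrable t m)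
    exact Real.arccos_le_pi_div_two.1
      (by linarith [arccos_inner_le_integral he h1 h, hn a t ht.1])
  · have := intervalIntegral.integral_add_adjacent_intervals (μ := volume) (hc.intervalIntegrable m t)
      (hc.intervalIntegrable t b)
    rw [real_inner_comm]
    exact Real.arccos_le_pi_div_two.1
      (by linarith [arccos_inner_le_integral he h1 h, hn t b ht.2])

end SphericalCurves

/-- The zeros of a function in a compact interval are finite in number if they are all simple. -/
lemma finite_zeros_of_deriv_ne_zero {ρ : ℝ → ℝ} (hρ : Differentiable ℝ ρ)
    (h : ∀ t, ρ t = 0 → deriv ρ t ≠ 0) (a b : ℝ) : {t | t ∈ Icc a b ∧ ρ t = 0}.Finite := by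
  by_contra hinf
  obtain ⟨c, -, hacc⟩ := Set.Infinite.exists_accPt_of_subset_isCompact hinf
    (isCompact_Icc (a := a) (b := b)) fun t ht => ht.1
  have hfreq : ∃ᶠ t in 𝓝[≠] c, ρ t = 0 :=
    (accPt_iff_frequently_nhdsNE.1 hacc).mono fun t ht => ht.2
  have hc : ρ c = 0 := by
    have hcl : IsClosed {t | ρ t = 0} := isClosed_eq hρ.continuous continuous_const
    exact hcl.mem_of_frequently_of_tendsto hfreq (tendsto_id.mono_left nhdsWithin_le_nhds)
  exact hfreq ((hρ c).hasDerivAt.eventually_ne (h c hc))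

/-! ### Frontals: the factorization `γ' = ρ e` and the length bounds for `e`. -/

section Frontals

variable {r : ℕ} {γ : ℝ → EuclideanSpace ℝ (Fin (r + 1))}

/-- This turns total curvature into the length of `e`. In `γ'' = ρ e' + ρ' e` the second term is
parallel to `γ'` and drops out of the Gram determinant, leaving `(ρ² ‖e'‖)²`. -/
lemma curvatureDensity_eq_norm_deriv {e : ℝ → EuclideanSpace ℝ (Fin (r + 1))} {ρ : ℝ → ℝ}
    (he : Differentiable ℝ e) (h1 : ∀ t, ‖e t‖ = 1) (hρ : Differentiable ℝ ρ)
    (hγ : deriv γ = fun t => ρ t • e t) {t : ℝ} (ht : ρ t ≠ 0) :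
    curvatureDensity γ t = ‖deriv e t‖ := by
  have h2 : deriv (deriv γ) t = ρ t • deriv e t + deriv ρ t • e t := by
    rw [hγ]; exact ((hρ t).hasDerivAt.smul (he t).hasDerivAt).deriv
  have h0 := inner_deriv_eq_zero_of_norm_eq_one he h1 t
  have h0' : ⟪deriv e t, e t⟫ = 0 := by rw [real_inner_comm]; exact h0
  have hn : ‖ρ t • deriv e t + deriv ρ t • e t‖ ^ 2
      = ρ t ^ 2 * ‖deriv e t‖ ^ 2 + deriv ρ t ^ 2 := by
    rw [norm_add_sq_real, inner_smul_left, inner_smul_right, h0', norm_smul, norm_smul, h1,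
      Real.norm_eq_abs, Real.norm_eq_abs, mul_pow, mul_pow, sq_abs, sq_abs]
    ring
  have hi : inner ℝ (ρ t • deriv e t + deriv ρ t • e t) (ρ t • e t) = deriv ρ t * ρ t := by
    rw [inner_add_left, inner_smul_left, inner_smul_left, inner_smul_right, inner_smul_right, h0',
      real_inner_self_eq_norm_sq, h1]
    simp
  have hg : ‖deriv γ t‖ = |ρ t| := by
    rw [hγ]; simp [norm_smul, h1]
  have hpos : 0 < |ρ t| := abs_pos.2 ht
  have hgt : deriv γ t = ρ t • e t := by rw [hγ]
  rw [curvatureDensity, curvature, hg, h2, hn, hgt, hi]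
  have hrad : (ρ t ^ 2 * ‖deriv e t‖ ^ 2 + deriv ρ t ^ 2) * |ρ t| ^ 2 - (deriv ρ t * ρ t) ^ 2
      = (|ρ t| ^ 2 * ‖deriv e t‖) ^ 2 := by
    rw [sq_abs]; ring
  rw [hrad, Real.sqrt_sq (by positivity)]
  field_simp

lemma curvatureDensity_periodic {T : ℝ} (hγ : Function.Periodic γ T) :
    Function.Periodic (curvatureDensity γ) T := by
  have hd : ∀ {f : ℝ → EuclideanSpace ℝ (Fin (r + 1))}, Function.Periodic f T →
      Function.Periodic (deriv f) T := fun {f} hf t => by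
    rw [← deriv_comp_add_const, show (fun x => f (x + T)) = f from funext hf]
  intro t
  simp only [curvatureDensity, curvature, hd hγ t, hd (hd hγ) t]

/-- A smooth closed frontal with only simple zeros of its speed factors as `γ' = ρ e`. -/
lemma IsClosedFrontal.exists_factorization (hγ : IsClosedFrontal γ)
    (hcusp : ∀ c : ℝ, deriv γ c = 0 → IsGeneralizedCusp γ c) :
    ∃ (e : ℝ → EuclideanSpace ℝ (Fin (r + 1))) (ρ : ℝ → ℝ), ContDiff ℝ 1 e ∧
      (∀ t, ‖e t‖ = 1) ∧ Differentiable ℝ ρ ∧ deriv γ = (fun t => ρ t • e t) ∧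
      ∀ t, ρ t = 0 → deriv ρ t ≠ 0 := by
  obtain ⟨e, he, h1, hs⟩ := hγ.exists_unitTangent
  have hdγ : Differentiable ℝ (deriv γ) :=
    ((contDiff_infty_iff_deriv.1 hγ.smooth).2).differentiable (by simp)
  have hde : Differentiable ℝ e := he.differentiable (by simp)
  have heq : deriv γ = fun t => ⟪e t, deriv γ t⟫ • e t := by
    funext t
    obtain ⟨c, hc⟩ := Submodule.mem_span_singleton.1 (hs t)
    simp only [← hc, inner_smul_right, real_inner_self_eq_norm_sq, h1]
    simp
  have hρ : Differentiable ℝ fun t => ⟪e t, deriv γ t⟫ := hde.inner ℝ hdγ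
  -- At a zero of `ρ` one has `γ'' = ρ' e`, so the cusp condition gives `ρ' ≠ 0`.
  refine ⟨e, fun t => ⟪e t, deriv γ t⟫, he.of_le (by simp), h1, hρ, heq, fun t ht hd => ?_⟩
  have hc := hcusp t (by rw [heq]; simp only at ht; simp [ht])
  apply hc.2
  have := ((hρ t).hasDerivAt.smul (hde t).hasDerivAt).deriv
  simp only at ht
  rw [heq, show (fun t => ⟪e t, deriv γ t⟫ • e t) = (fun t => ⟪e t, deriv γ t⟫) • e from rfl, this,
    hd, ht]
  simp

lemma sign_of_continuousOn_ne_zero {ρ : ℝ → ℝ} {s : Set ℝ} (hs : IsPreconnected s)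
    (hρ : ContinuousOn ρ s) (h : ∀ t ∈ s, ρ t ≠ 0) :
    (∀ t ∈ s, 0 < ρ t) ∨ ∀ t ∈ s, ρ t < 0 := by
  by_contra! hcon
  obtain ⟨⟨x, hx, hx0⟩, ⟨y, hy, hy0⟩⟩ := hcon
  obtain ⟨z, hz, hz0⟩ := hs.intermediate_value hx hy hρ ⟨hx0, hy0⟩
  exact h z hz hz0

variable {e : ℝ → EuclideanSpace ℝ (Fin (r + 1))} {ρ : ℝ → ℝ}

lemma hasDerivAt_inner_of_deriv_eq_smul (hγ : Differentiable ℝ γ)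
    (heq : deriv γ = fun t => ρ t • e t) (v : EuclideanSpace ℝ (Fin (r + 1))) (t : ℝ) :
    HasDerivAt (fun t => ⟪γ t, v⟫) (ρ t * ⟪e t, v⟫) t := by
  have h := (hγ t).hasDerivAt.inner ℝ (hasDerivAt_const t v)
  rw [heq] at h
  simpa [inner_smul_left] using h

/-- Fenchel's inequality. -/
lemma two_pi_le_length_of_ne_zero (hγ : Differentiable ℝ γ) (he : ContDiff ℝ 1 e)
    (h1 : ∀ t, ‖e t‖ = 1) (hρ : Continuous ρ) (heq : deriv γ = fun t => ρ t • e t)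
    {a b : ℝ} (hab : a < b) (hval : γ a = γ b) (hdval : deriv γ a = deriv γ b)
    (hne : ∀ t ∈ Icc a b, ρ t ≠ 0) : 2 * π ≤ ∫ u in a..b, ‖deriv e u‖ := by
  by_contra! hlt
  have ha := left_mem_Icc.2 hab.le
  have hb := right_mem_Icc.2 hab.le
  have hsm : ρ a • e a = ρ b • e b := by simpa [heq] using hdval
  have habs : |ρ a| = |ρ b| := by
    have := congrArg norm hsm
    simpa [norm_smul, h1] using this
  have hρab : ρ a = ρ b := by
    -- Equal velocities determine `e` only up to sign; the constant sign of `ρ` excludes `e b = -e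
    -- a`.
    rcases sign_of_continuousOn_ne_zero isPreconnected_Icc hρ.continuousOn hne with h | h
    · rwa [abs_of_pos (h a ha), abs_of_pos (h b hb)] at habs
    · rw [abs_of_neg (h a ha), abs_of_neg (h b hb)] at habs
      exact neg_injective habs
  have hclosed : e a = e b := by
    rw [← hρab] at hsm
    exact smul_right_injective _ (hne a ha) hsm
  obtain ⟨v, hv⟩ := exists_inner_pos_of_length_lt_two_pi he h1 hab.le hclosed hlt
  have hder := hasDerivAt_inner_of_deriv_eq_smul hγ heq v
  obtain ⟨c, hc, hc0⟩ := exists_hasDerivAt_eq_zero hab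
    (fun t _ => (hder t).continuousAt.continuousWithinAt) (by simp [hval]) fun t _ => hder t
  have hc' := Ioo_subset_Icc_self hc
  exact mul_ne_zero (hne c hc') (hv c hc').ne' hc0

/-- A closed curve whose speed vanishes at the endpoints only has total curvature above `π`. -/
lemma pi_lt_length_of_ne_zero (hγ : Differentiable ℝ γ) (he : ContDiff ℝ 1 e)
    (h1 : ∀ t, ‖e t‖ = 1) (hρ : Continuous ρ) (heq : deriv γ = fun t => ρ t • e t)
    {a b : ℝ} (hab : a < b) (hval : γ a = γ b)
    (hne : ∀ t ∈ Ioo a b, ρ t ≠ 0) : π < ∫ u in a..b, ‖deriv e u‖ := by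
  by_contra! hle
  obtain ⟨m, hm, hnn⟩ := exists_inner_nonneg_of_length_le_pi he h1 hab.le hle
  have hder := hasDerivAt_inner_of_deriv_eq_smul hγ heq (e m)
  have hcont : Continuous fun t => ⟪γ t, e m⟫ := hγ.continuous.inner continuous_const
  have hconst : ∀ t ∈ Icc a b, ⟪γ t, e m⟫ = ⟪γ a, e m⟫ := by
    intro t ht
    have ha := left_mem_Icc.2 hab.le
    have hb := right_mem_Icc.2 hab.le
    rcases sign_of_continuousOn_ne_zero isPreconnected_Ioo hρ.continuousOn hne with h | h
    · have hmono : MonotoneOn (fun t => ⟪γ t, e m⟫) (Icc a b) :=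
        monotoneOn_of_deriv_nonneg (convex_Icc a b) hcont.continuousOn
          (fun t _ => (hder t).differentiableAt.differentiableWithinAt) fun t ht => by
            rw [interior_Icc] at ht
            rw [(hder t).deriv]
            exact mul_nonneg (h t ht).le (hnn t (Ioo_subset_Icc_self ht))
      refine le_antisymm ?_ (hmono ha ht ht.1)
      rw [hval]; exact hmono ht hb ht.2
    · have hmono : AntitoneOn (fun t => ⟪γ t, e m⟫) (Icc a b) :=
        antitoneOn_of_deriv_nonpos (convex_Icc a b) hcont.continuousOn
          (fun t _ => (hder t).differentiableAt.differentiableWithinAt) fun t ht => by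
            rw [interior_Icc] at ht
            rw [(hder t).deriv]
            exact mul_nonpos_of_nonpos_of_nonneg (h t ht).le (hnn t (Ioo_subset_Icc_self ht))
      refine le_antisymm (hmono ha ht ht.1) ?_
      rw [hval]; exact hmono ht hb ht.2
  have hzero : ∀ t ∈ Ioo a b, ⟪e t, e m⟫ = 0 := by
    intro t ht
    have hev : (fun t => ⟪γ t, e m⟫) =ᶠ[𝓝 t] fun _ => ⟪γ a, e m⟫ := by
      filter_upwards [Icc_mem_nhds ht.1 ht.2] with u hu using hconst u hu
    have := (hder t).unique ((hasDerivAt_const t _).congr_of_eventuallyEq hev)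
    exact (mul_eq_zero.1 this).resolve_left (hne t ht)
  have hcl : IsClosed {t | ⟪e t, e m⟫ = 0} :=
    isClosed_eq (he.continuous.inner continuous_const) continuous_const
  -- `m` could be an endpoint, so the orthogonality is extended to the closed interval by
  -- continuity.
  have hmem : m ∈ {t | ⟪e t, e m⟫ = 0} := by
    have := closure_minimal (fun t ht => hzero t ht : Ioo a b ⊆ {t | ⟪e t, e m⟫ = 0}) hcl
    rw [closure_Ioo hab.ne] at this
    exact this hm
  simp [h1] at hmem

/-- A curve with constant unit tangent traces out a segment. -/
lemma exists_image_eq_segment (hγ : Differentiable ℝ γ) (he : ContDiff ℝ 1 e)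
    (h1 : ∀ t, ‖e t‖ = 1) (heq : deriv γ = fun t => ρ t • e t) {a b : ℝ} (hab : a ≤ b)
    (hL : ∫ u in a..b, ‖deriv e u‖ = 0) :
    ∃ p q : EuclideanSpace ℝ (Fin (r + 1)), γ '' Icc a b = segment ℝ p q := by
  have hconst : ∀ t ∈ Icc a b, e t = e a := by
    intro t ht
    have hc : Continuous fun u => ‖deriv e u‖ := (he.continuous_deriv le_rfl).norm
    have hsplit := intervalIntegral.integral_add_adjacent_intervals (μ := volume) (hc.intervalIntegrable a t)
      (hc.intervalIntegrable t b)
    have htb : 0 ≤ ∫ u in t..b, ‖deriv e u‖ :=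
      intervalIntegral.integral_nonneg ht.2 fun _ _ => norm_nonneg _
    have hle : Real.arccos ⟪e a, e t⟫ ≤ 0 := by
      linarith [arccos_inner_le_integral he h1 ht.1]
    have hone : 1 ≤ ⟪e a, e t⟫ := Real.arccos_eq_zero.1 (le_antisymm hle (Real.arccos_nonneg _))
    have hone' : ⟪e a, e t⟫ = 1 := le_antisymm
      (by simpa [h1] using real_inner_le_norm (e a) (e t)) hone
    exact ((inner_eq_one_iff_of_norm_eq_one (h1 a) (h1 t)).1 hone').symm
  -- The coordinate of `γ` along the constant direction `e a`; its image is a compact interval,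
  -- whose ends give the ends of the segment.
  set f : ℝ → ℝ := fun t => ⟪γ t, e a⟫ - ⟪γ a, e a⟫ with hf
  have hfc : ContinuousOn f (Icc a b) :=
    ((hγ.continuous.inner continuous_const).sub continuous_const).continuousOn
  have hline : ∀ t ∈ Icc a b, γ t = γ a + f t • e a := by
    have hder : ∀ t, HasDerivAt (fun t => γ t - f t • e a)
        (ρ t • e t - (ρ t * ⟪e t, e a⟫) • e a) t := fun t => by
      have h := (hγ t).hasDerivAt
      rw [heq] at h
      exact h.sub (((hasDerivAt_inner_of_deriv_eq_smul hγ heq (e a) t).sub_const _).smul_const _)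
    intro t ht
    have := constant_of_has_deriv_right_zero (f := fun t => γ t - f t • e a)
      (fun t _ => (hder t).continuousAt.continuousWithinAt)
      (fun t ht => by
        have h := (hder t).hasDerivWithinAt (s := Ici t)
        rw [hconst t (Ico_subset_Icc_self ht), real_inner_self_eq_norm_sq, h1] at h
        simpa using h) t ht
    simp only [hf, sub_self, zero_smul, sub_zero] at this ⊢
    exact sub_eq_iff_eq_add.1 this
  set g : ℝ →ᵃ[ℝ] EuclideanSpace ℝ (Fin (r + 1)) :=
    AffineMap.lineMap (γ a) (γ a + e a) with hg
  have hgf : ∀ t ∈ Icc a b, γ t = g (f t) := fun t ht => by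
    rw [hline t ht, hg, AffineMap.lineMap_apply]
    simp [add_comm]
  refine ⟨g (sInf (f '' Icc a b)), g (sSup (f '' Icc a b)), ?_⟩
  have himg := hfc.image_Icc hab
  have hle : sInf (f '' Icc a b) ≤ sSup (f '' Icc a b) := by
    have hne : (f '' Icc a b).Nonempty := (nonempty_Icc.2 hab).image f
    rw [himg] at hne
    exact nonempty_Icc.1 hne
  rw [← image_segment ℝ g, segment_eq_Icc hle, ← himg, image_image]
  exact image_congr hgf

/-- A curve contained in a line has vanishing curvature. -/
lemma curvatureDensity_eq_zero_of_range_subset_segment (hγ : ContDiff ℝ ∞ γ)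
    {p q : EuclideanSpace ℝ (Fin (r + 1))} (hpq : p ≠ q) (h : range γ ⊆ segment ℝ p q) (t : ℝ) :
    curvatureDensity γ t = 0 := by
  have hw : ‖q - p‖ ≠ 0 := norm_ne_zero_iff.2 (sub_ne_zero.2 hpq.symm)
  -- The segment parameter, given by an orthogonal projection so that it is visibly smooth in `t`.
  set f : ℝ → ℝ := fun t => ⟪γ t - p, q - p⟫ / ‖q - p‖ ^ 2 with hf
  have hfs : ContDiff ℝ ∞ f := ((hγ.sub contDiff_const).inner ℝ contDiff_const).div_const _
  have hγf : γ = fun t => p + f t • (q - p) := by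
    funext t
    have hmem := h (mem_range_self t)
    rw [segment_eq_image'] at hmem
    obtain ⟨θ, -, hθ⟩ := hmem
    have : f t = θ := by
      simp only [hf, ← hθ, add_sub_cancel_left, inner_smul_left, real_inner_self_eq_norm_sq]
      simp [hw]
    rw [this]; exact hθ.symm
  have hd1 : deriv γ = fun t => deriv f t • (q - p) := by
    funext t
    conv_lhs => rw [hγf]
    exact (((hfs.differentiable (by simp) t).hasDerivAt.smul_const (q - p)).const_add p).deriv
  have hd2 : deriv (deriv γ) t = deriv (deriv f) t • (q - p) := by
    rw [hd1]
    exact ((((contDiff_infty_iff_deriv.1 hfs).2).differentiable (by simp) t).hasDerivAt.smul_const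
      (q - p)).deriv
  have hrad : ‖deriv (deriv γ) t‖ ^ 2 * ‖deriv γ t‖ ^ 2
      - inner ℝ (deriv (deriv γ) t) (deriv γ t) ^ 2 = 0 := by
    rw [hd2, hd1]
    simp only [norm_smul, inner_smul_left, inner_smul_right, real_inner_self_eq_norm_sq,
      mul_pow, Real.norm_eq_abs, sq_abs]
    simp
    ring
  rw [curvatureDensity, curvature, hrad]
  simp

end Frontals

/-! ### The main theorem: counting cusps. -/

theorem mainTheorem3 (r : ℕ) (γ : ℝ → EuclideanSpace ℝ (Fin (r + 1)))
    (hγ : IsClosedFrontal γ)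
    (hcusp : ∀ c : ℝ, deriv γ c = 0 → IsGeneralizedCusp γ c) :
    (singularSet γ).Finite ∧
    IntervalIntegrable (curvatureDensity γ) MeasureTheory.volume 0 (2 * π) ∧
    2 ≤ (1 / π) * (∫ t in (0 : ℝ)..(2 * π), curvatureDensity γ t) + ((singularSet γ).ncard : ℝ) ∧
    ((singularSet γ).Nonempty →
      ((1 / π) * (∫ t in (0 : ℝ)..(2 * π), curvatureDensity γ t)
          + ((singularSet γ).ncard : ℝ) = 2 ↔
        (singularSet γ).ncard = 2 ∧
          ∃ a b : EuclideanSpace ℝ (Fin (r + 1)), a ≠ b ∧ Set.range γ = segment ℝ a b)) := by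
  obtain ⟨e, ρ, he, h1, hρ, heq, hsimple⟩ := hγ.exists_factorization hcusp
  have hdγ : Differentiable ℝ γ := hγ.smooth.differentiable (by simp)
  have hde : Differentiable ℝ e := he.differentiable one_ne_zero
  have hzero : ∀ t, deriv γ t = 0 ↔ ρ t = 0 := fun t => by
    have : e t ≠ 0 := norm_ne_zero_iff.1 (by simp [h1])
    simp [heq, this]
  have hdper : Function.Periodic (deriv γ) (2 * π) := fun t => by
    rw [← deriv_comp_add_const, show (fun x => γ (x + 2 * π)) = γ from funext hγ.periodic]
  have h2π : (0 : ℝ) < 2 * π := Real.two_pi_pos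
  have hfin : (singularSet γ).Finite :=
    (finite_zeros_of_deriv_ne_zero hρ hsimple 0 (2 * π)).subset
      fun t ht => ⟨Ico_subset_Icc_self ht.1, (hzero t).1 ht.2⟩
  -- At a cusp the density is `0` by the convention for division, while `e'` may not vanish; such
  -- points form a null set.
  have hae : ∀ a b : ℝ, a ≤ b →
      (fun t => ‖deriv e t‖) =ᵐ[volume.restrict (uIoc a b)] curvatureDensity γ := by
    intro a b hab
    rw [uIoc_of_le hab, EventuallyEq, ae_restrict_iff' measurableSet_Ioc]
    have hnull := (finite_zeros_of_deriv_ne_zero hρ hsimple a b).measure_zero volume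
    filter_upwards [measure_eq_zero_iff_ae_notMem.1 hnull] with t ht htab
    refine (curvatureDensity_eq_norm_deriv hde h1 hρ heq fun h0 => ?_).symm
    exact ht ⟨Ioc_subset_Icc_self htab, h0⟩
  have hint : ∀ a b : ℝ, a ≤ b →
      ∫ t in a..b, curvatureDensity γ t = ∫ t in a..b, ‖deriv e t‖ := fun a b hab =>
    (intervalIntegral.integral_congr_ae_restrict (hae a b hab)).symm
  have hii : IntervalIntegrable (curvatureDensity γ) volume 0 (2 * π) :=
    (((he.continuous_deriv le_rfl).norm).intervalIntegrable 0 (2 * π)).congr_ae (hae _ _ h2π.le)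
  set L := ∫ t in (0 : ℝ)..(2 * π), curvatureDensity γ t with hL
  have hL0 : 0 ≤ L := by
    rw [hL, hint _ _ h2π.le]
    exact intervalIntegral.integral_nonneg h2π.le fun _ _ => norm_nonneg _
  have hLπ : 0 ≤ 1 / π * L := mul_nonneg (by positivity) hL0
  have hnone : (singularSet γ).ncard = 0 → 2 * π ≤ L := by
    intro h0
    have hempty := (ncard_eq_zero hfin).1 h0
    have hne : ∀ t ∈ Icc 0 (2 * π), ρ t ≠ 0 := by
      intro t ht ht0
      rcases ht.2.lt_or_eq with hlt | rfl
      · exact (hempty ▸ notMem_empty t) (show t ∈ singularSet γ from ⟨⟨ht.1, hlt⟩, (hzero t).2 ht0⟩)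
      -- The endpoint `2π` is outside the fundamental domain and is identified with `0`.
      · refine (hempty ▸ notMem_empty 0) (show (0 : ℝ) ∈ singularSet γ from ⟨⟨le_rfl, h2π⟩, ?_⟩)
        rw [← hdper 0, zero_add]
        exact (hzero _).2 ht0
    rw [hL, hint _ _ h2π.le]
    exact two_pi_le_length_of_ne_zero hdγ he h1 hρ.continuous heq h2π
      (by simpa using (hγ.periodic 0).symm) (by simpa using (hdper 0).symm) hne
  have hone : (singularSet γ).ncard = 1 → π < L := by
    intro h0
    obtain ⟨a, ha⟩ := ncard_eq_one.1 h0
    -- The period is started at the only cusp `a`; points past `2π` are moved back by one period.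
    have hne : ∀ t ∈ Ioo a (a + 2 * π), ρ t ≠ 0 := by
      intro t ht ht0
      have hamem : a ∈ singularSet γ := ha ▸ mem_singleton a
      have hdt := (hzero t).2 ht0
      rcases lt_or_ge t (2 * π) with hlt | hge
      · have : t ∈ singularSet γ := ⟨⟨hamem.1.1.trans ht.1.le, hlt⟩, hdt⟩
        rw [ha] at this
        exact ht.1.ne' this
      · have : t - 2 * π ∈ singularSet γ :=
          ⟨⟨by linarith, by linarith [ht.2, hamem.1.2]⟩, by rw [hdper.sub_eq]; exact hdt⟩
        rw [ha] at this
        have h3 : t - 2 * π = a := this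
        linarith [ht.2]
    have hshift := (curvatureDensity_periodic hγ.periodic).intervalIntegral_add_eq a 0
    rw [zero_add] at hshift
    rw [hL, ← hshift, hint _ _ (by linarith)]
    exact pi_lt_length_of_ne_zero hdγ he h1 hρ.continuous heq (by linarith)
      (hγ.periodic a).symm hne
  refine ⟨hfin, hii, ?_, fun hnonempty => ⟨fun hsum => ?_, ?_⟩⟩
  · rcases Nat.lt_or_ge (singularSet γ).ncard 2 with hlt | hge
    · interval_cases h : (singularSet γ).ncard
      · have := (le_div_iff₀ Real.pi_pos).2 (hnone rfl)
        rw [one_div_mul_eq_div]; push_cast; linarith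
      · have := (lt_div_iff₀ Real.pi_pos).2 (by simpa using hone rfl : 1 * π < L)
        rw [one_div_mul_eq_div]; push_cast; linarith
    · have : (2 : ℝ) ≤ (singularSet γ).ncard := by exact_mod_cast hge
      linarith
  · have hle : (singularSet γ).ncard ≤ 2 := by
      have : ((singularSet γ).ncard : ℝ) ≤ 2 := by linarith
      exact_mod_cast this
    have hpos := (ncard_pos hfin).2 hnonempty
    have hcard : (singularSet γ).ncard = 2 := by
      by_contra hne2
      have hc1 : (singularSet γ).ncard = 1 := by omega
      have := (lt_div_iff₀ Real.pi_pos).2 (by simpa using hone hc1 : 1 * π < L)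
      rw [hc1, one_div_mul_eq_div] at hsum
      push_cast at hsum
      linarith
    refine ⟨hcard, ?_⟩
    have hLzero : L = 0 := by
      rw [hcard] at hsum
      push_cast at hsum
      have : 1 / π * L = 0 := by linarith
      exact (mul_eq_zero.1 this).resolve_left (by positivity)
    rw [hL, hint _ _ h2π.le] at hLzero
    obtain ⟨p, q, hpq⟩ := exists_image_eq_segment hdγ he h1 heq h2π.le hLzero
    have hrange : range γ = segment ℝ p q := by
      rw [← hpq, ← hγ.periodic.image_Icc h2π 0, zero_add]
    refine ⟨p, q, ?_, hrange⟩
    rintro rfl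
    rw [segment_same] at hrange
    have hconst : γ = fun _ => p := funext fun t => by
      have := mem_range_self (f := γ) t
      rwa [hrange] at this
    -- A regular point exists, so `γ` is not constant and the endpoints differ.
    obtain ⟨t, ht⟩ := hγ.dense_regular.nonempty
    exact ht (by rw [hconst]; simp)
  · rintro ⟨hcard, p, q, hpq, hrange⟩
    have hLzero : L = 0 := by
      rw [hL]
      simp [curvatureDensity_eq_zero_of_range_subset_segment hγ.smooth hpq hrange.subset]
    rw [hcard, hLzero]
    norm_num
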